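/- Let $F$ be a field of characteristic different from $2$. Let $W(F)$ be its Witt ring, $I(F)$ the ideal of classes of even-dimensional nonsingular quadratic forms, $W_t(F)$ the torsion part of $W(F)$, and $I_t(F)=I(F)\cap W_t(F)$. Put \[A_t(F)=\{f\in\mathbb{Z}[X] : f(\varphi)=0 \text{ in } W(F) \text{ for all } \varphi\in I_t(F)\},\qquad A'_t(F)=A_t(F)\cap X\mathbb{Z}[X].\] Let $r\ge 1$ be an integer and let $k=k(r)\geq 1$ be the unique integer with $\nu_2((2k-2)!)<r\le\nu_2((2k)!)$, where $\nu_2$ is the $2$-adic valuation. Let $J'_{e,r}$ be the ideal of $\mathbb{Z}[X]$ generated by the monomials $2^rX$, $2^{r-\nu_2((2i)!)}X^{2i}$ for $1\le i\le k-1$, and $X^{2k}$. If $2^rW_t(F)=0$, then each of these generators vanishes at every element of $I_t(F)$, and \[J'_{e,r}\subseteq A'_t(F).\] -/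

import Mathlib

universe u

namespace QuadWitt

open QuadraticMap TensorProduct

/-- A nonsingular quadratic form over `F`: a finite-dimensional vector space with a nondegenerate
quadratic form on it. -/
structure QuadSpace (F : Type u) [Field F] : Type (u + 1) where
  carrier : Type u
  [addCommGroup : AddCommGroup carrier]
  [module : Module F carrier]
  [finiteDimensional : FiniteDimensional F carrier]
  form : QuadraticForm F carrier
  nondegenerate : form.Nondegenerate

attribute [instance] QuadSpace.addCommGroup QuadSpace.module QuadSpace.finiteDimensional

/-- The dimension of a quadratic form. -/
noncomputable def QuadSpace.dim {F : Type u} [Field F] (Q : QuadSpace F) : ℕ :=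
  Module.finrank F Q.carrier

section Nondegeneracy

variable {F : Type u} [Field F] [Invertible (2 : F)]
variable {V W : Type u} [AddCommGroup V] [Module F V] [AddCommGroup W] [Module F W]

theorem nondegenerate_iff_separating (Q : QuadraticForm F V) :
    Q.Nondegenerate ↔ ∀ x, (∀ y, associated (R := F) Q x y = 0) → x = 0 := by
  rw [nondegenerate_iff_radical_eq_bot, radical_eq_ker_associated,
    ← LinearMap.separatingLeft_iff_ker_eq_bot]
  rfl

theorem nondegenerate_iff_polar (Q : QuadraticForm F V) :
    Q.Nondegenerate ↔ ∀ x, (∀ y, polar Q x y = 0) → x = 0 := by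
  rw [nondegenerate_iff_radical_eq_bot, radical_eq_ker_polarBilin,
    ← LinearMap.separatingLeft_iff_ker_eq_bot]
  rfl

theorem nondegenerate_prod {Q : QuadraticForm F V} {P : QuadraticForm F W}
    (hQ : Q.Nondegenerate) (hP : P.Nondegenerate) : (Q.prod P).Nondegenerate := by
  rw [nondegenerate_iff_separating] at *
  rintro ⟨x, y⟩ h
  refine Prod.ext (hQ x fun z => ?_) (hP y fun z => ?_)
  · simpa using h (z, 0)
  · simpa using h (0, z)

theorem nondegenerate_neg {Q : QuadraticForm F V} (hQ : Q.Nondegenerate) :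
    (-Q).Nondegenerate := by
  rw [nondegenerate_iff_separating] at *
  intro x h
  exact hQ x fun y => by simpa using h y

theorem nondegenerate_tmul [FiniteDimensional F V] [FiniteDimensional F W]
    {Q : QuadraticForm F V} {P : QuadraticForm F W}
    (hQ : Q.Nondegenerate) (hP : P.Nondegenerate) :
    (QuadraticForm.tmul Q P).Nondegenerate := by
  rw [← nondegenerate_associated_iff] at hQ hP
  rw [nondegenerate_iff_separating]
  let e := (TensorProduct.congr (LinearMap.BilinForm.toDual _ hQ)
    (LinearMap.BilinForm.toDual _ hP)).trans (TensorProduct.dualDistribEquiv F V W)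
  have he : associated (R := F) (QuadraticForm.tmul Q P) = e.toLinearMap := by
    rw [QuadraticForm.associated_tmul]
    ext a b c d
    simp [e, LinearMap.BilinForm.toDual_def, mul_comm]
  intro x hx
  have h0 : associated (R := F) (QuadraticForm.tmul Q P) x = 0 := LinearMap.ext hx
  rw [he] at h0
  exact e.injective (h0.trans (map_zero e).symm)

theorem nondegenerate_dualProd [FiniteDimensional F V] :
    (QuadraticForm.dualProd F V).Nondegenerate := by
  rw [nondegenerate_iff_polar]
  rintro ⟨f, v⟩ h
  have key : ∀ (g : Module.Dual F V) (w : V), f w + g v = 0 := by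
    intro g w
    have hgw := h (g, w)
    simp only [polar, QuadraticForm.dualProd_apply, Prod.mk_add_mk,
      LinearMap.add_apply, map_add] at hgw
    rw [← hgw]
    ring
  refine Prod.ext (LinearMap.ext fun w => by simpa using key 0 w) ?_
  exact (Module.forall_dual_apply_eq_zero_iff F v).1 fun g => by simpa using key g 0

theorem nondegenerate_sq : (sq (R := F) : QuadraticForm F F).Nondegenerate := by
  rw [nondegenerate_iff_separating]
  intro x h
  simpa using h 1

theorem nondegenerate_zero : (0 : QuadraticForm F PUnit.{u + 1}).Nondegenerate := by
  rw [nondegenerate_iff_separating]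
  intro x _
  rfl

end Nondegeneracy

section Isometries

theorem dualProd_equivalent_fin {F V : Type u} [Field F] [AddCommGroup V] [Module F V]
    [FiniteDimensional F V] :
    (QuadraticForm.dualProd F V).Equivalent
      (QuadraticForm.dualProd F (Fin (Module.finrank F V) → F)) :=
  ⟨QuadraticForm.dualProdIsometry (Module.finBasis F V).equivFun⟩

variable {F : Type u} [Field F] [Invertible (2 : F)]
variable {V W U : Type u} [AddCommGroup V] [Module F V] [AddCommGroup W] [Module F W]
  [AddCommGroup U] [Module F U]

/-- `Q ⊥ -Q` is isometric to the hyperbolic space on `V`. -/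
theorem prod_neg_equivalent [FiniteDimensional F V] {Q : QuadraticForm F V}
    (hQ : Q.Nondegenerate) : (Q.prod (-Q)).Equivalent (QuadraticForm.dualProd F V) := by
  have hinj : Function.Injective (QuadraticForm.toDualProd Q).toLinearMap := by
    rw [injective_iff_map_eq_zero]
    intro x hx
    refine (nondegenerate_iff_separating _).1
      (nondegenerate_prod hQ (nondegenerate_neg hQ)) x fun y => ?_
    have h : ∀ z, (Q.prod (-Q)) z = QuadraticForm.dualProd F V
        ((QuadraticForm.toDualProd Q).toLinearMap z) :=
      fun z => ((QuadraticForm.toDualProd Q).map_app z).symm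
    rw [associated_apply, h, h, h, map_add, hx]
    simp
  have hd : Module.finrank F (V × V) = Module.finrank F (Module.Dual F V × V) := by
    simp [Module.finrank_prod, Subspace.dual_finrank_eq]
  exact ⟨{ LinearEquiv.ofInjectiveOfFinrankEq _ hinj hd with
    map_app' := fun x => (QuadraticForm.toDualProd Q).map_app x }⟩

theorem tmul_prod_equivalent (Q : QuadraticForm F V) (P : QuadraticForm F W)
    (R : QuadraticForm F U) :
    (QuadraticForm.tmul Q (P.prod R)).Equivalent
      ((QuadraticForm.tmul Q P).prod (QuadraticForm.tmul Q R)) := by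
  have h : ((QuadraticForm.tmul Q P).prod (QuadraticForm.tmul Q R)).comp
      (TensorProduct.prodRight F F V W U).toLinearMap = QuadraticForm.tmul Q (P.prod R) := by
    refine (QuadraticMap.associated_rightInverse F).injective ?_
    ext <;> simp [QuadraticForm.associated_tmul, QuadraticMap.associated_comp]
  exact ⟨{ TensorProduct.prodRight F F V W U with
    map_app' := fun x => DFunLike.congr_fun h x }⟩

theorem tmul_neg_form (Q : QuadraticForm F V) (P : QuadraticForm F W) :
    QuadraticForm.tmul Q (-P) = -QuadraticForm.tmul Q P := by
  rw [← map_neg, ← TensorProduct.tmul_neg]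

theorem Equivalent.tmul {V' W' : Type u} [AddCommGroup V'] [Module F V'] [AddCommGroup W']
    [Module F W'] {Q : QuadraticForm F V} {P : QuadraticForm F W} {Q' : QuadraticForm F V'}
    {P' : QuadraticForm F W'} (h₁ : Q.Equivalent Q') (h₂ : P.Equivalent P') :
    (QuadraticForm.tmul Q P).Equivalent (QuadraticForm.tmul Q' P') := by
  obtain ⟨f⟩ := h₁
  obtain ⟨g⟩ := h₂
  exact ⟨{ TensorProduct.congr f.toLinearEquiv g.toLinearEquiv with
    map_app' := fun x => QuadraticForm.tmul_tensorMap_apply f.toIsometry g.toIsometry x }⟩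

/-- The tensor product of a form on `V` with an `n`-fold hyperbolic plane is hyperbolic. -/
theorem tmul_dualProd_equivalent [FiniteDimensional F V] {Q : QuadraticForm F V}
    (hQ : Q.Nondegenerate) (n : ℕ) :
    (QuadraticForm.tmul Q (QuadraticForm.dualProd F (Fin n → F))).Equivalent
      (QuadraticForm.dualProd F (V ⊗[F] (Fin n → F))) := by
  have : NeZero (2 : F) := ⟨Invertible.ne_zero 2⟩
  have hP : (weightedSumSquares F (1 : Fin n → F)).Nondegenerate := by
    rw [nondegenerate_iff_radical_eq_bot]
    exact (QuadraticForm.radical_weightedSumSquares (𝕜 := F) (w := (1 : Fin n → F))).trans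
      (by ext; simp [Pi.mem_spanSubset_iff, funext_iff])
  refine (Equivalent.tmul (.refl Q) (prod_neg_equivalent hP).symm).trans
    ((tmul_prod_equivalent _ _ _).trans ?_)
  rw [tmul_neg_form]
  exact prod_neg_equivalent (nondegenerate_tmul hQ hP)

end Isometries

section IsometryClasses

variable (F : Type u) [Field F]

/-- Isometry of quadratic forms. -/
instance isometrySetoid : Setoid (QuadSpace F) where
  r Q P := Q.form.Equivalent P.form
  iseqv := ⟨fun Q => .refl Q.form, fun h => h.symm, fun h h' => h.trans h'⟩

/-- Isometry classes of nonsingular quadratic forms over `F`. -/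
def FormClass : Type (u + 1) := Quotient (isometrySetoid F)

variable {F} [Invertible (2 : F)]

/-- The orthogonal sum `Q ⊥ P`. -/
def QuadSpace.orthSum (Q P : QuadSpace F) : QuadSpace F where
  carrier := Q.carrier × P.carrier
  form := Q.form.prod P.form
  nondegenerate := nondegenerate_prod Q.nondegenerate P.nondegenerate

/-- The tensor product `Q ⊗ P`, with `(Q ⊗ P)(x ⊗ y) = Q(x) P(y)`. -/
noncomputable def QuadSpace.tensor (Q P : QuadSpace F) : QuadSpace F where
  carrier := Q.carrier ⊗[F] P.carrier
  form := QuadraticForm.tmul Q.form P.form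
  nondegenerate := nondegenerate_tmul Q.nondegenerate P.nondegenerate

/-- The form `-Q`. -/
def QuadSpace.opp (Q : QuadSpace F) : QuadSpace F where
  carrier := Q.carrier
  form := -Q.form
  nondegenerate := nondegenerate_neg Q.nondegenerate

variable (F)

/-- The zero-dimensional form. -/
def QuadSpace.nil : QuadSpace F where
  carrier := PUnit.{u + 1}
  form := 0
  nondegenerate := nondegenerate_zero

/-- The one-dimensional form `⟨1⟩`. -/
def QuadSpace.unit : QuadSpace F where
  carrier := F
  form := sq
  nondegenerate := nondegenerate_sq

/-- The orthogonal sum of `n` hyperbolic planes: the form `(f, x) ↦ f(x)` on `(Fⁿ)* × Fⁿ`,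
in dual coordinates `f₁ x₁ + ⋯ + fₙ xₙ`. -/
def QuadSpace.hyperbolic (n : ℕ) : QuadSpace F where
  carrier := Module.Dual F (Fin n → F) × (Fin n → F)
  form := QuadraticForm.dualProd F (Fin n → F)
  nondegenerate := nondegenerate_dualProd

namespace FormClass

instance : Zero (FormClass F) := ⟨Quotient.mk _ (QuadSpace.nil F)⟩

instance : One (FormClass F) := ⟨Quotient.mk _ (QuadSpace.unit F)⟩

instance : Add (FormClass F) :=
  ⟨Quotient.map₂ QuadSpace.orthSum fun _ _ h _ _ h' => Equivalent.prod h h'⟩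

noncomputable instance : Mul (FormClass F) :=
  ⟨Quotient.map₂ QuadSpace.tensor fun _ _ h _ _ h' => Equivalent.tmul h h'⟩

theorem add_comm' (x y : FormClass F) : x + y = y + x := by
  induction x, y using Quotient.inductionOn₂ with
  | h Q P => exact Quotient.sound ⟨IsometryEquiv.prodComm Q.form P.form⟩

theorem zero_add' (x : FormClass F) : 0 + x = x := by
  induction x using Quotient.inductionOn with
  | h Q =>
    refine Quotient.sound ⟨{ (LinearEquiv.uniqueProd : (PUnit.{u + 1} × Q.carrier) ≃ₗ[F] _) with
      map_app' := fun m => ?_ }⟩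
    change Q.form m.2 = (0 : F) + Q.form m.2
    rw [zero_add]

theorem mul_comm' (x y : FormClass F) : x * y = y * x := by
  induction x, y using Quotient.inductionOn₂ with
  | h Q P => exact Quotient.sound ⟨QuadraticForm.tensorComm Q.form P.form⟩

theorem one_mul' (x : FormClass F) : 1 * x = x := by
  induction x using Quotient.inductionOn with
  | h Q => exact Quotient.sound ⟨QuadraticForm.tensorLId Q.form⟩

theorem mul_add' (x y z : FormClass F) : x * (y + z) = x * y + x * z := by
  induction x, y, z using Quotient.inductionOn₃ with
  | h Q P R => exact Quotient.sound (tmul_prod_equivalent Q.form P.form R.form)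

theorem mul_zero' (x : FormClass F) : x * 0 = 0 := by
  induction x using Quotient.inductionOn with
  | h Q =>
    refine Quotient.sound ⟨{ (0 : (Q.carrier ⊗[F] PUnit.{u + 1}) →ₗ[F] PUnit.{u + 1}) with
      invFun := 0
      left_inv := fun x => ?_
      right_inv := fun _ => rfl
      map_app' := fun x => ?_ }⟩
    · exact Subsingleton.elim (α := Q.carrier ⊗[F] PUnit.{u + 1}) _ _
    · have hx : x = 0 := Subsingleton.elim (α := Q.carrier ⊗[F] PUnit.{u + 1}) x 0
      rw [hx]
      exact (QuadraticMap.map_zero _).symm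

noncomputable instance : CommSemiring (FormClass F) where
  add_assoc x y z := by
    induction x, y, z using Quotient.inductionOn₃ with
    | h Q P R =>
      exact Quotient.sound ⟨{ LinearEquiv.prodAssoc F Q.carrier P.carrier R.carrier with
        map_app' := fun m => (add_assoc (Q.form m.1.1) (P.form m.1.2) (R.form m.2)).symm }⟩
  zero_add := zero_add' F
  add_zero x := by rw [add_comm', zero_add']
  add_comm := add_comm' F
  nsmul := nsmulRec
  left_distrib := mul_add' F
  right_distrib x y z := by rw [mul_comm', mul_add', mul_comm' F z x, mul_comm' F z y]
  zero_mul x := by rw [mul_comm', mul_zero']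
  mul_zero := mul_zero' F
  mul_assoc x y z := by
    induction x, y, z using Quotient.inductionOn₃ with
    | h Q P R => exact Quotient.sound ⟨QuadraticForm.tensorAssoc Q.form P.form R.form⟩
  one_mul := one_mul' F
  mul_one x := by rw [mul_comm', one_mul']
  mul_comm := mul_comm' F

/-- The isometry class of an orthogonal sum of `n` hyperbolic planes. -/
def hyp (n : ℕ) : FormClass F := Quotient.mk _ (QuadSpace.hyperbolic F n)

theorem hyp_add (m n : ℕ) : hyp F (m + n) = hyp F m + hyp F n := by
  refine Quotient.sound ?_
  have h : ((Fin m → F) × (Fin n → F)) ≃ₗ[F] (Fin (m + n) → F) :=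
    LinearEquiv.ofFinrankEq _ _ (by simp)
  exact (Equivalent.symm ⟨QuadraticForm.dualProdIsometry h⟩).trans
    ⟨QuadraticForm.dualProdProdIsometry⟩

theorem hyp_zero : hyp F 0 = 0 := by
  refine Quotient.sound ⟨{ (0 : (Module.Dual F (Fin 0 → F) × (Fin 0 → F)) →ₗ[F] PUnit.{u + 1}) with
      invFun := 0
      left_inv := fun x => ?_
      right_inv := fun _ => rfl
      map_app' := fun x => ?_ }⟩
  · exact Subsingleton.elim (α := Module.Dual F (Fin 0 → F) × (Fin 0 → F)) _ _
  · have hx : x = 0 := Subsingleton.elim (α := Module.Dual F (Fin 0 → F) × (Fin 0 → F)) x 0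
    rw [hx]
    exact (QuadraticMap.map_zero _).symm

theorem exists_mul_hyp (x : FormClass F) (n : ℕ) : ∃ m, x * hyp F n = hyp F m := by
  induction x using Quotient.inductionOn with
  | h Q =>
    exact ⟨_, Quotient.sound
      ((tmul_dualProd_equivalent Q.nondegenerate n).trans dualProd_equivalent_fin)⟩

end FormClass

end IsometryClasses

section WittRing

variable (F : Type u) [Field F] [Invertible (2 : F)]

open QuadWitt.FormClass

/-- Witt equivalence: two forms become isometric after adding hyperbolic planes to both. -/
noncomputable def wittCon : RingCon (FormClass F) where
  r x y := ∃ m n : ℕ, x + hyp F m = y + hyp F n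
  iseqv := by
    refine ⟨fun x => ⟨0, 0, rfl⟩, fun ⟨m, n, h⟩ => ⟨n, m, h.symm⟩, ?_⟩
    rintro x y z ⟨m, n, h⟩ ⟨p, q, h'⟩
    refine ⟨m + p, q + n, ?_⟩
    rw [hyp_add, hyp_add, ← add_assoc, ← add_assoc, h, ← h']
    abel
  add' := by
    rintro x y z w ⟨m, n, h⟩ ⟨p, q, h'⟩
    refine ⟨m + p, n + q, ?_⟩
    rw [hyp_add, hyp_add, add_add_add_comm, h, h', add_add_add_comm]
  mul' := by
    rintro x y z w ⟨m, n, h⟩ ⟨p, q, h'⟩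
    have key : ∀ {a b c : FormClass F} {i j : ℕ}, a + hyp F i = b + hyp F j →
        ∃ i' j', c * a + hyp F i' = c * b + hyp F j' := by
      intro a b c i j hab
      obtain ⟨i', hi⟩ := exists_mul_hyp F c i
      obtain ⟨j', hj⟩ := exists_mul_hyp F c j
      exact ⟨i', j', by rw [← hi, ← hj, ← mul_add, hab, mul_add]⟩
    obtain ⟨a, b, h₁⟩ := key (c := z) h
    obtain ⟨c, d, h₂⟩ := key (c := y) h'
    rw [mul_comm z, mul_comm z] at h₁
    refine ⟨a + c, d + b, ?_⟩
    rw [hyp_add, hyp_add, ← add_assoc, ← add_assoc, h₁, ← h₂]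
    abel

/-- The Witt ring `W(F)`: nonsingular quadratic forms up to Witt equivalence, with addition induced
by the orthogonal sum and multiplication induced by the tensor product. -/
noncomputable def WittRing : Type (u + 1) := (wittCon F).Quotient

noncomputable instance : CommSemiring (WittRing F) :=
  inferInstanceAs (CommSemiring (wittCon F).Quotient)

variable {F}

/-- The Witt class of a nonsingular quadratic form. -/
noncomputable def WittRing.mk (Q : QuadSpace F) : WittRing F :=
  (wittCon F).toQuotient (Quotient.mk (isometrySetoid F) Q)

theorem WittRing.mk_surjective (x : WittRing F) : ∃ Q, WittRing.mk Q = x := by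
  obtain ⟨y, rfl⟩ := Quotient.exists_rep x
  obtain ⟨Q, rfl⟩ := Quotient.exists_rep y
  exact ⟨Q, rfl⟩

theorem WittRing.mk_eq_iff (Q P : QuadSpace F) :
    WittRing.mk Q = WittRing.mk P ↔ ∃ m n : ℕ,
      (Q.orthSum (QuadSpace.hyperbolic F m)).form.Equivalent
        (P.orthSum (QuadSpace.hyperbolic F n)).form := by
  refine ((wittCon F).eq).trans (exists_congr fun m => exists_congr fun n => ?_)
  exact Quotient.eq

theorem WittRing.mk_add (Q P : QuadSpace F) :
    WittRing.mk Q + WittRing.mk P = WittRing.mk (Q.orthSum P) := rfl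

theorem WittRing.mk_mul (Q P : QuadSpace F) :
    WittRing.mk Q * WittRing.mk P = WittRing.mk (Q.tensor P) := rfl

theorem WittRing.mk_one : WittRing.mk (QuadSpace.unit F) = 1 := rfl

theorem WittRing.mk_zero : WittRing.mk (QuadSpace.nil F) = 0 := rfl

/-- Negation on `W(F)`, induced by `Q ↦ -Q`. -/
noncomputable def WittRing.neg : WittRing F → WittRing F :=
  Quotient.lift
    (Quotient.lift (fun Q : QuadSpace F => WittRing.mk Q.opp) (by
      rintro Q P ⟨f⟩
      refine congrArg (wittCon F).toQuotient (Quotient.sound ⟨{ f.toLinearEquiv with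
        map_app' := fun m => ?_ }⟩)
      exact congrArg Neg.neg (f.map_app m)))
    (by
      have hopp : ∀ Q : QuadSpace F, WittRing.mk Q.opp + WittRing.mk Q = 0 := by
        intro Q
        rw [add_comm]
        refine ((wittCon F).eq).2 ⟨0, Module.finrank F Q.carrier, ?_⟩
        rw [hyp_zero, add_zero, zero_add]
        exact Quotient.sound ((prod_neg_equivalent Q.nondegenerate).trans dualProd_equivalent_fin)
      intro x y h
      obtain ⟨Q, rfl⟩ := Quotient.exists_rep x
      obtain ⟨P, rfl⟩ := Quotient.exists_rep y
      have h' : WittRing.mk Q = WittRing.mk P := ((wittCon F).eq).2 h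
      change WittRing.mk Q.opp = WittRing.mk P.opp
      calc WittRing.mk Q.opp = WittRing.mk Q.opp + (WittRing.mk P.opp + WittRing.mk P) := by
            rw [hopp, add_zero]
        _ = (WittRing.mk Q.opp + WittRing.mk Q) + WittRing.mk P.opp := by
            rw [h', add_assoc, add_comm (WittRing.mk P)]
        _ = WittRing.mk P.opp := by rw [hopp, zero_add])

variable (F)

noncomputable instance : Neg (WittRing F) := ⟨WittRing.neg⟩

noncomputable instance : CommRing (WittRing F) where
  __ := (inferInstance : CommSemiring (WittRing F))
  zsmul := zsmulRec
  neg_add_cancel x := by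
    obtain ⟨Q, rfl⟩ := WittRing.mk_surjective x
    rw [add_comm]
    refine ((wittCon F).eq).2 ⟨0, Module.finrank F Q.carrier, ?_⟩
    rw [hyp_zero, add_zero, zero_add]
    exact Quotient.sound ((prod_neg_equivalent Q.nondegenerate).trans dualProd_equivalent_fin)

/-- The fundamental ideal `I(F)`: the classes of even-dimensional forms. -/
def fundamentalIdeal : Ideal (WittRing F) where
  carrier := {x | ∃ Q : QuadSpace F, Even Q.dim ∧ WittRing.mk Q = x}
  zero_mem' := by
    refine ⟨QuadSpace.nil F, ?_, rfl⟩
    have h : (QuadSpace.nil F).dim = 0 := Module.finrank_zero_of_subsingleton (M := PUnit.{u + 1})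
    simp [h]
  add_mem' := by
    rintro _ _ ⟨Q, hQ, rfl⟩ ⟨P, hP, rfl⟩
    refine ⟨Q.orthSum P, ?_, rfl⟩
    have : (Q.orthSum P).dim = Q.dim + P.dim := Module.finrank_prod
    rw [this]
    exact hQ.add hP
  smul_mem' := by
    rintro c _ ⟨P, hP, rfl⟩
    obtain ⟨Q, rfl⟩ := WittRing.mk_surjective c
    refine ⟨Q.tensor P, ?_, rfl⟩
    have : (Q.tensor P).dim = Q.dim * P.dim := Module.finrank_tensorProduct ..
    rw [this]
    exact hP.mul_left _

/-- The torsion part `W_t(F)` of the Witt ring. -/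
def torsionPart : Set (WittRing F) := {x | ∃ n : ℕ, 0 < n ∧ n • x = 0}

/-- `I_t(F) = I(F) ∩ W_t(F)`. -/
def evenTorsion : Set (WittRing F) := (fundamentalIdeal F : Set (WittRing F)) ∩ torsionPart F

open Polynomial

/-- The torsion annihilator ideal `A_t(F)` of `ℤ[X]`. -/
noncomputable def torsionAnnihilator : Ideal ℤ[X] where
  carrier := {f | ∀ φ ∈ evenTorsion F, aeval φ f = 0}
  zero_mem' φ _ := map_zero _
  add_mem' {f g} hf hg φ hφ := by rw [map_add, hf φ hφ, hg φ hφ, add_zero]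
  smul_mem' c f hf φ hφ := by rw [smul_eq_mul, map_mul, hf φ hφ, mul_zero]

/-- `A'_t(F) = A_t(F) ∩ X ℤ[X]`. -/
noncomputable def torsionAnnihilator' : Ideal ℤ[X] := torsionAnnihilator F ⊓ Ideal.span {X}

/-- The monomials `2^r X`, `2^(r - ν₂((2i)!)) X^(2i)` for `1 ≤ i ≤ k - 1`, and `X^(2k)`. -/
def evenGenerators (r k : ℕ) : Set ℤ[X] :=
  {C (2 ^ r) * X} ∪
    {f | ∃ i : ℕ, 1 ≤ i ∧ i ≤ k - 1 ∧
      f = C (2 ^ (r - padicValNat 2 (Nat.factorial (2 * i)))) * X ^ (2 * i)} ∪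
    {X ^ (2 * k)}

/-- The ideal `J'_{e,r}` of `ℤ[X]`, where `k = k(r)`. -/
noncomputable def evenIdeal (r k : ℕ) : Ideal ℤ[X] := Ideal.span (evenGenerators r k)

end WittRing

end QuadWitt

/-!
Write `⟨a⟩` for the Witt class of the form `a x²`. A class `φ ∈ I(F)` with `2 ^ r φ = 0` is a sum
of classes `⟨a⟩ - ⟨c⟩` which are themselves killed by `2 ^ r`. This is clear if `2 ^ r = 0` in
`W(F)`. Otherwise let `⟨a₁, …, aₙ⟩` represent `φ`. As `2 ^ r φ = 0`, the form `2 ^ r ⟨a₁, …, aₙ⟩` is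
isotropic, so `a₁ q₁ + ⋯ + aₙ qₙ = 0` for some sums `qᵢ` of `2 ^ r` squares, not all zero. By
Pfister's theorem `2 ^ r ⟨qᵢ⟩ = 2 ^ r` whenever `qᵢ ≠ 0`; replacing `aᵢ` by `aᵢ qᵢ` therefore
changes `φ` by a class `⟨aᵢ⟩ - ⟨aᵢ qᵢ⟩` killed by `2 ^ r`, and afterwards a hyperbolic plane splits
off.

For `u = ⟨a⟩ - ⟨c⟩` one has `u ^ 2 = 2 ⟨a⟩ u`, so `u ^ n` is `2 ^ (n - 1)` times a multiple of `u`,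
and `ν₂(n!) ≤ n - 1`. Hence `u ^ n ∈ 2 ^ ν₂(n!) A` for `n ≥ 1`, where `A` is the annihilator of
`2 ^ r`. As in the theory of divided powers, this property is inherited by sums, so that
`φ ^ n ∈ 2 ^ ν₂(n!) A`.
-/

section DividedPowers

theorem pow_padicValNat_factorial_dvd_choose_mul (p : ℕ) [Fact p.Prime] (i j : ℕ) :
    p ^ padicValNat p (i + j).factorial ∣
      (i + j).choose i * (p ^ padicValNat p i.factorial * p ^ padicValNat p j.factorial) := by
  rw [Nat.choose_symm_add]
  have hchoose : (i + j).choose j ≠ 0 := (Nat.choose_pos (Nat.le_add_left j i)).ne'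
  have hval : padicValNat p (i + j).factorial =
      padicValNat p ((i + j).choose j) +
        (padicValNat p i.factorial + padicValNat p j.factorial) := by
    rw [← Nat.add_choose_mul_factorial_mul_factorial, mul_assoc,
      padicValNat.mul hchoose (mul_ne_zero i.factorial_ne_zero j.factorial_ne_zero),
      padicValNat.mul i.factorial_ne_zero j.factorial_ne_zero]
  rw [hval, pow_add, pow_add]
  exact mul_dvd_mul_right pow_padicValNat_dvd _

variable {R : Type*} [CommRing R]

/-- The elements `x` whose powers satisfy `x ^ n ∈ p ^ ν_p(n!) A` for all `n ≥ 1`. If the primes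
other than `p` are invertible in `R`, this says that `x ^ n ∈ n! A`. -/
def dividedPowerSubmonoid (p : ℕ) [Fact p.Prime] (A : Ideal R) : AddSubmonoid R where
  carrier := {x | ∀ n ≠ 0, x ^ n ∈ Ideal.span {(p : R) ^ padicValNat p n.factorial} * A}
  zero_mem' n hn := by simp only [zero_pow hn, zero_mem]
  add_mem' {x y} hx hy n hn := by
    rw [(Commute.all x y).add_pow']
    refine sum_mem fun ⟨i, j⟩ hij => ?_
    obtain rfl : i + j = n := Finset.HasAntidiagonal.mem_antidiagonal.1 hij
    rcases eq_or_ne i 0 with rfl | hi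
    · simpa using hy _ hn
    rcases eq_or_ne j 0 with rfl | hj
    · simpa using hx _ hn
    obtain ⟨s, hs, hsx⟩ := Ideal.mem_span_singleton_mul.1 (hx i hi)
    obtain ⟨t, -, hty⟩ := Ideal.mem_span_singleton_mul.1 (hy j hj)
    obtain ⟨c, hc⟩ := pow_padicValNat_factorial_dvd_choose_mul p i j
    have hc' := congrArg (Nat.cast (R := R)) hc
    push_cast at hc'
    refine Ideal.mem_span_singleton_mul.2 ⟨c * t * s, A.mul_mem_left _ hs, ?_⟩
    rw [nsmul_eq_mul, ← hsx, ← hty]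
    linear_combination (-(s * t)) * hc'

variable {p : ℕ} [Fact p.Prime] {A : Ideal R} {x : R}

theorem mem_dividedPowerSubmonoid_of_mul_self_eq {y : R} (hx : x ∈ A) (hxy : x * x = p * y * x) :
    x ∈ dividedPowerSubmonoid p A := by
  have hpow : ∀ n, x ^ (n + 1) = p ^ n * (y ^ n * x) := by
    intro n
    induction n with
    | zero => simp
    | succ n ih =>
      rw [pow_succ, ih]
      linear_combination p ^ n * y ^ n * hxy
  intro n hn
  obtain ⟨n, rfl⟩ := Nat.exists_eq_succ_of_ne_zero hn
  have hval : padicValNat p (n + 1).factorial ≤ n :=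
    Nat.lt_succ_iff.1 (padicValNat_factorial_lt_of_ne_zero p hn)
  rw [hpow]
  exact Ideal.mul_mem_mul (Ideal.mem_span_singleton.2 (pow_dvd_pow _ hval)) (A.mul_mem_left _ hx)

theorem pow_sub_mul_pow_eq_zero_of_mem_dividedPowerSubmonoid {r : ℕ}
    (hA : ∀ z ∈ A, (p : R) ^ r * z = 0) (hx : x ∈ dividedPowerSubmonoid p A) {n : ℕ} (hn : n ≠ 0) :
    (p : R) ^ (r - padicValNat p n.factorial) * x ^ n = 0 := by
  obtain ⟨z, hz, hzx⟩ := Ideal.mem_span_singleton_mul.1 (hx n hn)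
  have hdvd : (p : R) ^ r ∣
      p ^ (r - padicValNat p n.factorial) * p ^ padicValNat p n.factorial := by
    rw [← pow_add]
    exact pow_dvd_pow _ le_tsub_add
  obtain ⟨c, hc⟩ := hdvd
  rw [← hzx, ← mul_assoc, hc, mul_right_comm, hA z hz, zero_mul]

end DividedPowers

section TotallyIsotropic

variable {K U V W : Type*} [Field K] [AddCommGroup U] [Module K U] [FiniteDimensional K U]
  [AddCommGroup V] [Module K V] [AddCommGroup W] [Module K W] [FiniteDimensional K W]

theorem finrank_le_of_totallyIsotropic {Q : QuadraticForm K V} (hQ : Q.Anisotropic)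
    {s : U →ₗ[K] V × Module.Dual K W × W} (hs : Function.Injective s)
    (hsQ : ∀ x, Q.prod (QuadraticForm.dualProd K W) (s x) = 0) :
    Module.finrank K U ≤ Module.finrank K W := by
  replace hsQ : ∀ x, Q (s x).1 + (s x).2.1 (s x).2.2 = 0 := hsQ
  let A : U →ₗ[K] Module.Dual K W := LinearMap.fst K _ _ ∘ₗ LinearMap.snd K _ _ ∘ₗ s
  let B : U →ₗ[K] W := LinearMap.snd K _ _ ∘ₗ LinearMap.snd K _ _ ∘ₗ s
  have hdual : ∀ x : LinearMap.ker A, (s x).2.1 = 0 := fun x => x.2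
  have hfst : ∀ x : LinearMap.ker A, (s x).1 = 0 := fun x =>
    hQ _ (by simpa only [hdual, LinearMap.zero_apply, add_zero] using hsQ x)
  have hB : Function.Injective (B.domRestrict (LinearMap.ker A)) :=
    (injective_iff_map_eq_zero _).2 fun x hx => Subtype.ext <| hs <|
      (Prod.ext (hfst x) (Prod.ext (hdual x) hx)).trans (map_zero s).symm
  have hrange : LinearMap.range A ≤
      (LinearMap.range (B.domRestrict (LinearMap.ker A))).dualAnnihilator := by
    rintro _ ⟨y, rfl⟩
    rw [Submodule.mem_dualAnnihilator]
    rintro _ ⟨x, rfl⟩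
    have hxy := hsQ (x + y)
    simp only [map_add, Prod.fst_add, Prod.snd_add, hfst, hdual, zero_add] at hxy
    change (s y).2.1 (s x).2.2 = 0
    linear_combination hxy - hsQ y
  calc Module.finrank K U
      = Module.finrank K (LinearMap.range A) + Module.finrank K (LinearMap.ker A) :=
        A.finrank_range_add_finrank_ker.symm
    _ ≤ Module.finrank K (LinearMap.range (B.domRestrict (LinearMap.ker A))).dualAnnihilator +
          Module.finrank K (LinearMap.range (B.domRestrict (LinearMap.ker A))) :=
        add_le_add (Submodule.finrank_mono hrange) (LinearMap.finrank_range_of_inj hB).ge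
    _ = Module.finrank K W := by
        rw [add_comm, Subspace.finrank_add_finrank_dualAnnihilator_eq]

end TotallyIsotropic

namespace QuadWitt

open QuadraticMap

variable {F : Type u} [Field F] [Invertible (2 : F)]

namespace WittRing

theorem mk_eq_of_equivalent {Q P : QuadSpace F} (h : Q.form.Equivalent P.form) : mk Q = mk P :=
  congrArg (wittCon F).toQuotient (Quotient.sound h)

theorem not_anisotropic_of_mk_eq_zero {Q : QuadSpace F} (hdim : Q.dim ≠ 0) (hQ : mk Q = 0) :
    ¬ Q.form.Anisotropic := by
  intro haniso
  rw [← mk_zero, mk_eq_iff] at hQ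
  obtain ⟨m, n, ⟨f⟩⟩ := hQ
  let e : (Q.carrier × Module.Dual F (Fin m → F) × (Fin m → F)) ≃ₗ[F]
    (PUnit.{u + 1} × Module.Dual F (Fin n → F) × (Fin n → F)) := f.toLinearEquiv
  let s : (Fin n → F) →ₗ[F] (Q.carrier × Module.Dual F (Fin m → F) × (Fin m → F)) :=
    e.symm.toLinearMap ∘ₗ LinearMap.inr F _ _ ∘ₗ LinearMap.inr F _ _
  have hs : Function.Injective s :=
    e.symm.injective.comp (LinearMap.inr_injective.comp LinearMap.inr_injective)
  have hisotropic : ∀ y, Q.form.prod (QuadraticForm.dualProd F (Fin m → F)) (s y) = 0 := by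
    intro y
    refine (f.symm.map_app (PUnit.unit, 0, y)).trans ?_
    change (0 : F) + (0 : Module.Dual F (Fin n → F)) y = 0
    rw [LinearMap.zero_apply, add_zero]
  have hle := finrank_le_of_totallyIsotropic haniso hs hisotropic
  have hfinrank := e.finrank_eq
  simp only [Module.finrank_prod, Subspace.dual_finrank_eq, Module.finrank_fin_fun,
    Module.finrank_zero_of_subsingleton (M := PUnit.{u + 1})] at hle hfinrank
  change Module.finrank F Q.carrier ≠ 0 at hdim
  lia

end WittRing

section DiagonalForms

/-- The one-dimensional form `⟨a⟩`. -/
def QuadSpace.rankOne (a : Fˣ) : QuadSpace F where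
  carrier := F
  form := (a : F) • QuadraticMap.sq
  nondegenerate := (nondegenerate_iff_separating _).2 fun x h => by simpa using h 1

theorem QuadSpace.dim_rankOne (a : Fˣ) : (rankOne a).dim = 1 := Module.finrank_self F

theorem QuadSpace.dim_orthSum (Q P : QuadSpace F) : (Q.orthSum P).dim = Q.dim + P.dim :=
  Module.finrank_prod

/-- The Witt class of the one-dimensional form `⟨a⟩`, as a multiplicative function of `a`. -/
noncomputable def rankOneClass : Fˣ →* WittRing F where
  toFun a := WittRing.mk (QuadSpace.rankOne a)
  map_one' := by
    refine WittRing.mk_eq_of_equivalent (P := QuadSpace.unit F)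
      ⟨{ LinearEquiv.refl F F with map_app' := fun (x : F) => ?_ }⟩
    change x * x = ((1 : Fˣ) : F) * (x * x)
    rw [Units.val_one, one_mul]
  map_mul' a b := by
    refine WittRing.mk_eq_of_equivalent (P := (QuadSpace.rankOne a).tensor (QuadSpace.rankOne b))
      ⟨{ (TensorProduct.lid F F).symm with map_app' := fun (x : F) => ?_ }⟩
    refine (QuadraticForm.tensorDistrib_tmul (R := F) (A := F) (QuadSpace.rankOne a).form
      (QuadSpace.rankOne b).form (1 : F) x).trans ?_
    change (b * (x * x)) * (a * (1 * 1)) = ((a * b : Fˣ) : F) * (x * x)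
    push_cast
    ring

theorem rankOneClass_mul_self (a : Fˣ) : rankOneClass a * rankOneClass a = 1 := by
  rw [← map_mul, ← map_one rankOneClass]
  refine WittRing.mk_eq_of_equivalent
    ⟨{ LinearEquiv.smulOfUnit a with map_app' := fun (x : F) => ?_ }⟩
  change ((1 : Fˣ) : F) * ((a * x) * (a * x)) = ((a * a : Fˣ) : F) * (x * x)
  push_cast
  ring

theorem rankOneClass_neg (a : Fˣ) : rankOneClass (-a) = -rankOneClass a := by
  refine WittRing.mk_eq_of_equivalent (P := (QuadSpace.rankOne a).opp)
    ⟨{ LinearEquiv.refl F F with map_app' := fun (x : F) => ?_ }⟩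
  change -((a : F) * (x * x)) = ((-a : Fˣ) : F) * (x * x)
  rw [Units.val_neg, neg_mul]

theorem rankOneClass_add_rankOneClass {a b c : Fˣ} (h : (a : F) + b = c) :
    rankOneClass a + rankOneClass b = rankOneClass c + rankOneClass (a * b * c) := by
  have hc : (a : F) + b ≠ 0 := h ▸ c.ne_zero
  -- `(1, 1)` has value `c`, and `(b, -a)` spans its orthogonal complement.
  let e : (F × F) ≃ₗ[F] (F × F) :=
    { toFun := fun v => (v.1 + b * v.2, v.1 - a * v.2)
      map_add' := fun v w => by ext <;> simp only [Prod.fst_add, Prod.snd_add] <;> ring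
      map_smul' := fun t v => by
        ext <;> simp only [Prod.smul_fst, Prod.smul_snd, smul_eq_mul, RingHom.id_apply] <;> ring
      invFun := fun v => ((a * v.1 + b * v.2) / (a + b), (v.1 - v.2) / (a + b))
      left_inv := fun v => by ext <;> simp only <;> field_simp <;> ring
      right_inv := fun v => by ext <;> simp only <;> field_simp <;> ring }
  refine (WittRing.mk_eq_of_equivalent
    (Q := (QuadSpace.rankOne c).orthSum (QuadSpace.rankOne (a * b * c)))
    (P := (QuadSpace.rankOne a).orthSum (QuadSpace.rankOne b))
    ⟨{ e with map_app' := fun (v : F × F) => ?_ }⟩).symm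
  change (a : F) * ((v.1 + b * v.2) * (v.1 + b * v.2)) +
    b * ((v.1 - a * v.2) * (v.1 - a * v.2)) =
    c * (v.1 * v.1) + ((a * b * c : Fˣ) : F) * (v.2 * v.2)
  push_cast
  rw [← h]
  ring

/-- The diagonal form `⟨a₁, …, aₙ⟩`. -/
noncomputable def QuadSpace.diagonal {n : ℕ} (a : Fin n → Fˣ) : QuadSpace F where
  carrier := Fin n → F
  form := weightedSumSquares F a
  nondegenerate := by
    have : NeZero (2 : F) := ⟨Invertible.ne_zero 2⟩
    rw [nondegenerate_iff_radical_eq_bot]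
    exact (QuadraticForm.radical_weightedSumSquares (𝕜 := F) (w := fun i => (a i : F))).trans
      (by ext; simp [Pi.mem_spanSubset_iff, funext_iff])

theorem WittRing.mk_diagonal {n : ℕ} (a : Fin n → Fˣ) :
    mk (QuadSpace.diagonal a) = ∑ i, rankOneClass (a i) := by
  induction n with
  | zero =>
    rw [Fin.sum_univ_zero, ← mk_zero]
    refine mk_eq_of_equivalent ⟨{ (0 : (Fin 0 → F) →ₗ[F] PUnit.{u + 1}) with
      invFun := 0
      left_inv := fun _ => Subsingleton.elim (α := Fin 0 → F) _ _
      right_inv := fun _ => rfl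
      map_app' := fun x => ?_ }⟩
    exact ((weightedSumSquares_apply a x).trans (Fin.sum_univ_zero _)).symm
  | succ n ih =>
    rw [Fin.sum_univ_succ, ← ih]
    let e : (F × (Fin n → F)) ≃ₗ[F] (Fin (n + 1) → F) :=
      Fin.consLinearEquiv F fun _ : Fin (n + 1) => F
    refine (mk_eq_of_equivalent (P := QuadSpace.diagonal a)
      (Q := (QuadSpace.rankOne (a 0)).orthSum (QuadSpace.diagonal fun i => a i.succ))
      ⟨{ e with map_app' := fun (x : F × (Fin n → F)) => ?_ }⟩).symm
    change weightedSumSquares F a (Fin.cons x.1 x.2 : Fin (n + 1) → F) =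
      (a 0 : F) * (x.1 * x.1) + weightedSumSquares F (fun i => a i.succ) x.2
    rw [weightedSumSquares_apply, weightedSumSquares_apply, Fin.sum_univ_succ]
    rfl

theorem WittRing.exists_mk_eq_sum_rankOneClass (Q : QuadSpace F) :
    ∃ a : Fin Q.dim → Fˣ, mk Q = ∑ i, rankOneClass (a i) := by
  obtain ⟨a, ha⟩ := QuadraticForm.equivalent_weightedSumSquares_units_of_nondegenerate' Q.form
    ((nondegenerate_iff_separating _).1 Q.nondegenerate)
  exact ⟨a, (mk_eq_of_equivalent (P := QuadSpace.diagonal a) ha).trans (mk_diagonal a)⟩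

theorem exists_dim_eq_card_mk_eq_sum {ι : Type*} (S : Finset ι) (a : ι → Fˣ) :
    ∃ Q : QuadSpace F, Q.dim = S.card ∧ WittRing.mk Q = ∑ i ∈ S, rankOneClass (a i) := by
  refine ⟨QuadSpace.diagonal fun j => a (S.equivFin.symm j), Module.finrank_fin_fun F, ?_⟩
  rw [WittRing.mk_diagonal, S.equivFin.symm.sum_comp fun i : S => rankOneClass (a i),
    S.sum_coe_sort fun i => rankOneClass (a i)]

theorem exists_isotropic_of_sum_rankOneClass_eq_zero {ι : Type*} [Fintype ι] [Nonempty ι]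
    (a : ι → Fˣ) (h : ∑ i, rankOneClass (a i) = 0) :
    ∃ x : ι → F, x ≠ 0 ∧ ∑ i, (a i : F) * x i ^ 2 = 0 := by
  let e := Fintype.equivFin ι
  let Q := QuadSpace.diagonal fun j => a (e.symm j)
  have hdim : Q.dim ≠ 0 := (Module.finrank_fin_fun F).trans_ne Fintype.card_ne_zero
  have hQ : WittRing.mk Q = 0 := by
    rw [WittRing.mk_diagonal, e.symm.sum_comp fun i => rankOneClass (a i), h]
  have haniso := WittRing.not_anisotropic_of_mk_eq_zero hdim hQ
  simp only [Anisotropic, not_forall] at haniso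
  obtain ⟨v, hv, hv0⟩ := haniso
  refine ⟨fun i => v (e i), fun hx => hv0 ?_, ?_⟩
  · exact funext fun j => (congrArg v (e.apply_symm_apply j)).symm.trans (congrFun hx (e.symm j))
  · rw [← e.symm.sum_comp, ← hv]
    refine Eq.trans ?_ (weightedSumSquares_apply (fun j => a (e.symm j)) v).symm
    simp [Units.smul_def, pow_two]

theorem exists_dim_add_one_of_add_sum_eq_zero {ι : Type*} (S : Finset ι) (a : Fˣ) (c : ι → Fˣ)
    (h : (a : F) + ∑ i ∈ S, (c i : F) = 0) :
    ∃ Q : QuadSpace F, Q.dim + 1 = S.card ∧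
      WittRing.mk Q = rankOneClass a + ∑ i ∈ S, rankOneClass (c i) := by
  induction S using Finset.cons_induction generalizing a with
  | empty => simp at h
  | cons i S hi ih =>
    rw [Finset.sum_cons] at h
    simp only [Finset.card_cons, Finset.sum_cons]
    by_cases hac : (a : F) + c i = 0
    · obtain ⟨Q, hdim, hQ⟩ := exists_dim_eq_card_mk_eq_sum S c
      have hneg : c i = -a := Units.ext (by push_cast; exact (neg_eq_of_add_eq_zero_right hac).symm)
      exact ⟨Q, by rw [hdim], by rw [hQ, hneg, rankOneClass_neg, add_neg_cancel_left]⟩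
    · obtain ⟨Q, hdim, hQ⟩ := ih (Units.mk0 _ hac) (by rw [Units.val_mk0, add_assoc, h])
      refine ⟨(QuadSpace.rankOne (a * c i * Units.mk0 _ hac)).orthSum Q, ?_, ?_⟩
      · rw [QuadSpace.dim_orthSum, QuadSpace.dim_rankOne, ← hdim, add_comm 1]
      · have hadd : rankOneClass a + rankOneClass (c i) = _ :=
          rankOneClass_add_rankOneClass (Units.val_mk0 hac).symm
        rw [← WittRing.mk_add, hQ, ← add_assoc, ← add_assoc, hadd, add_comm (rankOneClass _)]
        rfl

theorem exists_dim_add_two_of_sum_eq_zero {ι : Type*} {S : Finset ι} (hS : S.Nonempty)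
    (c : ι → Fˣ) (h : ∑ i ∈ S, (c i : F) = 0) :
    ∃ Q : QuadSpace F, Q.dim + 2 = S.card ∧
      WittRing.mk Q = ∑ i ∈ S, rankOneClass (c i) := by
  classical
  obtain ⟨i, hi⟩ := hS
  rw [← Finset.add_sum_erase S _ hi] at h
  obtain ⟨Q, hdim, hQ⟩ := exists_dim_add_one_of_add_sum_eq_zero _ _ _ h
  exact ⟨Q, by rw [← Finset.card_erase_add_one hi, ← hdim],
    hQ.trans (Finset.add_sum_erase S (fun i => rankOneClass (c i)) hi)⟩

end DiagonalForms

section SumsOfSquares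

variable {ι : Type*}

theorem two_pow_mul_rankOneClass_of_sum_sq_eq {r : ℕ} {S : Finset ι} (hS : S.card = 2 ^ r)
    (x : ι → F) {b : Fˣ} (hb : ∑ j ∈ S, x j ^ 2 = b) : 2 ^ r * rankOneClass b = 2 ^ r := by
  classical
  induction r generalizing S b with
  | zero =>
    obtain ⟨j, rfl⟩ := Finset.card_eq_one.1 hS
    rw [Finset.sum_singleton] at hb
    have hx : x j ≠ 0 := fun h => b.ne_zero (by rw [← hb, h, zero_pow two_ne_zero])
    have hb' : b = Units.mk0 _ hx * Units.mk0 _ hx := Units.ext (by simpa [pow_two] using hb.symm)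
    rw [hb', map_mul, rankOneClass_mul_self, mul_one]
  | succ r ih =>
    obtain ⟨T, hTS, hT⟩ := Finset.exists_subset_card_eq (s := S) (n := 2 ^ r) (by lia)
    have hT' : (S \ T).card = 2 ^ r := by rw [Finset.card_sdiff_of_subset hTS]; lia
    rw [← Finset.sum_sdiff hTS] at hb
    by_cases hc : ∑ j ∈ T, x j ^ 2 = 0
    · rw [pow_succ, mul_right_comm, ih hT' (by rw [← hb, hc, add_zero])]
    by_cases hd : ∑ j ∈ S \ T, x j ^ 2 = 0
    · rw [pow_succ, mul_right_comm, ih hT (by rw [← hb, hd, zero_add])]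
    let c := Units.mk0 _ hc
    let d := Units.mk0 _ hd
    have hround_c : 2 ^ r * rankOneClass c = 2 ^ r := ih hT rfl
    have hround_d : 2 ^ r * rankOneClass d = 2 ^ r := ih hT' rfl
    have hadd : rankOneClass d + rankOneClass c = rankOneClass b + rankOneClass (d * c * b) :=
      rankOneClass_add_rankOneClass hb
    rw [map_mul, map_mul] at hadd
    linear_combination (-2 ^ r) * hadd + (1 - rankOneClass b) * hround_d +
      (1 - rankOneClass b * rankOneClass d) * hround_c

theorem two_pow_eq_zero_of_sum_sq_eq_zero {r : ℕ} {S : Finset ι} (hS : S.card = 2 ^ r)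
    {x : ι → F} (hx : ∃ j ∈ S, x j ≠ 0) (h : ∑ j ∈ S, x j ^ 2 = 0) :
    (2 ^ r : WittRing F) = 0 := by
  classical
  induction r generalizing S with
  | zero =>
    obtain ⟨i, rfl⟩ := Finset.card_eq_one.1 hS
    obtain ⟨j, hj, hxj⟩ := hx
    rw [Finset.mem_singleton.1 hj] at hxj
    rw [Finset.sum_singleton] at h
    exact absurd (pow_eq_zero_iff two_ne_zero |>.1 h) hxj
  | succ r ih =>
    obtain ⟨T, hTS, hT⟩ := Finset.exists_subset_card_eq (s := S) (n := 2 ^ r) (by lia)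
    have hT' : (S \ T).card = 2 ^ r := by rw [Finset.card_sdiff_of_subset hTS]; lia
    rw [← Finset.sum_sdiff hTS] at h
    by_cases hc : ∑ j ∈ T, x j ^ 2 = 0
    · have hd : ∑ j ∈ S \ T, x j ^ 2 = 0 := by rwa [hc, add_zero] at h
      obtain ⟨j, hj, hxj⟩ := hx
      have hzero : (2 ^ r : WittRing F) = 0 := by
        by_cases hjT : j ∈ T
        · exact ih hT ⟨j, hjT, hxj⟩ hc
        · exact ih hT' ⟨j, Finset.mem_sdiff.2 ⟨hj, hjT⟩, hxj⟩ hd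
      rw [pow_succ, hzero, zero_mul]
    · let c := Units.mk0 _ hc
      have hround : 2 ^ r * rankOneClass c = 2 ^ r :=
        two_pow_mul_rankOneClass_of_sum_sq_eq hT x rfl
      have hround_neg : 2 ^ r * rankOneClass (-c) = 2 ^ r :=
        two_pow_mul_rankOneClass_of_sum_sq_eq hT' x (eq_neg_of_add_eq_zero_left h)
      rw [rankOneClass_neg] at hround_neg
      linear_combination -hround - hround_neg

end SumsOfSquares

section BinaryTorsion

variable {r : ℕ}

variable (F r) in
/-- The classes of the binary forms `⟨a, -c⟩` that are killed by `2 ^ r`. -/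
def binaryTorsion : Set (WittRing F) :=
  {u | 2 ^ r * u = 0 ∧ ∃ a c : Fˣ, rankOneClass a - rankOneClass c = u}

theorem two_pow_mul_eq_zero_of_mem_closure_binaryTorsion {u : WittRing F}
    (hu : u ∈ AddSubmonoid.closure (binaryTorsion F r)) : 2 ^ r * u = 0 :=
  (AddSubmonoid.closure_le (S := AddMonoidHom.mker (AddMonoidHom.mulLeft (2 ^ r)))).2
    (fun _ hu => hu.1) hu

theorem mk_mem_closure_binaryTorsion_of_two_pow_eq_zero (h2 : (2 ^ r : WittRing F) = 0)
    {Q : QuadSpace F} (hQ : Even Q.dim) :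
    WittRing.mk Q ∈ AddSubmonoid.closure (binaryTorsion F r) := by
  have hsub : ∀ a c : Fˣ,
      rankOneClass a - rankOneClass c ∈ AddSubmonoid.closure (binaryTorsion F r) := fun a c =>
    AddSubmonoid.subset_closure ⟨by rw [h2, zero_mul], a, c, rfl⟩
  obtain ⟨a, ha⟩ := WittRing.exists_mk_eq_sum_rankOneClass Q
  obtain ⟨n, hn⟩ := hQ
  have hsum : WittRing.mk Q = ∑ i, (rankOneClass (a i) - rankOneClass 1) +
      n • (rankOneClass 1 - rankOneClass (-1)) := by
    rw [Finset.sum_sub_distrib, ← ha, Finset.sum_const, Finset.card_univ, Fintype.card_fin,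
      rankOneClass_neg, sub_neg_eq_add, hn, nsmul_add, add_nsmul, sub_add_cancel]
  rw [hsum]
  exact add_mem (sum_mem fun i _ => hsub _ _) (nsmul_mem (hsub _ _) n)

theorem exists_sum_mul_eq_zero_of_two_pow_mul_sum_eq_zero (h2 : (2 ^ r : WittRing F) ≠ 0)
    {ι : Type*} [Fintype ι] [Nonempty ι] (a : ι → Fˣ)
    (h : 2 ^ r * ∑ i, rankOneClass (a i) = 0) :
    ∃ (S : Finset ι) (b : ι → Fˣ), S.Nonempty ∧ (∀ i ∈ S, 2 ^ r * rankOneClass (b i) = 2 ^ r) ∧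
      ∑ i ∈ S, ((a i * b i : Fˣ) : F) = 0 := by
  classical
  obtain ⟨x, hx0, hx⟩ := exists_isotropic_of_sum_rankOneClass_eq_zero
    (fun k : ι × Fin (2 ^ r) => a k.1) (by
      rw [Fintype.sum_prod_type_right]
      simpa using h)
  let q : ι → F := fun i => ∑ j, x (i, j) ^ 2
  have hq : ∑ i, (a i : F) * q i = 0 := by
    simpa only [Fintype.sum_prod_type, ← Finset.mul_sum] using hx
  have hq0 : ∃ i, q i ≠ 0 := by
    obtain ⟨⟨i, j⟩, hij⟩ := Function.ne_iff.1 hx0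
    exact ⟨i, fun hi => h2 (two_pow_eq_zero_of_sum_sq_eq_zero (Finset.card_fin _)
      ⟨j, Finset.mem_univ j, hij⟩ hi)⟩
  let b : ι → Fˣ := fun i => if hi : q i = 0 then 1 else Units.mk0 (q i) hi
  have hb : ∀ i, q i ≠ 0 → (b i : F) = q i := fun i hi => by
    simp only [b, dif_neg hi, Units.val_mk0]
  refine ⟨({i | q i ≠ 0} : Finset ι), b, hq0.imp (by simp), fun i hi => ?_, ?_⟩
  · exact two_pow_mul_rankOneClass_of_sum_sq_eq (Finset.card_fin _) (fun j => x (i, j))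
      (hb i (Finset.mem_filter.1 hi).2).symm
  · refine (Finset.sum_filter _ _).trans ((Finset.sum_congr rfl fun i _ => ?_).trans hq)
    split_ifs with hi
    · rw [Units.val_mul, hb i hi]
    · rw [not_not.1 hi, mul_zero]

theorem exists_dim_add_two_sub_mem_closure_binaryTorsion (h2 : (2 ^ r : WittRing F) ≠ 0)
    {Q : QuadSpace F} (hdim : Q.dim ≠ 0) (hQ : 2 ^ r * WittRing.mk Q = 0) :
    ∃ P : QuadSpace F, P.dim + 2 = Q.dim ∧
      WittRing.mk Q - WittRing.mk P ∈ AddSubmonoid.closure (binaryTorsion F r) := by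
  obtain ⟨a, ha⟩ := WittRing.exists_mk_eq_sum_rankOneClass Q
  have : Nonempty (Fin Q.dim) := Fin.pos_iff_nonempty.1 (Nat.pos_of_ne_zero hdim)
  obtain ⟨S, b, hS, hb, hsum⟩ :=
    exists_sum_mul_eq_zero_of_two_pow_mul_sum_eq_zero h2 a (by rw [← ha, hQ])
  obtain ⟨P₁, hdim₁, hP₁⟩ := exists_dim_add_two_of_sum_eq_zero hS _ hsum
  obtain ⟨P₂, hdim₂, hP₂⟩ := exists_dim_eq_card_mk_eq_sum Sᶜ a
  refine ⟨P₁.orthSum P₂, ?_, ?_⟩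
  · have hcard := S.card_add_card_compl
    rw [Fintype.card_fin] at hcard
    rw [QuadSpace.dim_orthSum]
    lia
  · have hdiff : WittRing.mk Q - WittRing.mk (P₁.orthSum P₂) =
        ∑ i ∈ S, (rankOneClass (a i) - rankOneClass (a i * b i)) := by
      rw [← WittRing.mk_add, hP₁, hP₂, ha, ← Finset.sum_add_sum_compl S, add_sub_add_right_eq_sub,
        Finset.sum_sub_distrib]
    rw [hdiff]
    refine sum_mem fun i hi => AddSubmonoid.subset_closure ⟨?_, a i, a i * b i, rfl⟩
    rw [map_mul]
    linear_combination (-rankOneClass (a i)) * hb i hi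

theorem mk_mem_closure_binaryTorsion_of_two_pow_ne_zero (h2 : (2 ^ r : WittRing F) ≠ 0)
    (Q : QuadSpace F) (hQ : 2 ^ r * WittRing.mk Q = 0) :
    WittRing.mk Q ∈ AddSubmonoid.closure (binaryTorsion F r) := by
  induction hn : Q.dim using Nat.strong_induction_on generalizing Q with
  | h n ih =>
    rcases eq_or_ne Q.dim 0 with hdim | hdim
    · obtain ⟨a, ha⟩ := WittRing.exists_mk_eq_sum_rankOneClass Q
      have : IsEmpty (Fin Q.dim) := hdim ▸ Fin.isEmpty
      rw [ha, Finset.univ_eq_empty, Finset.sum_empty]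
      exact zero_mem _
    obtain ⟨P, hP, hmem⟩ := exists_dim_add_two_sub_mem_closure_binaryTorsion h2 hdim hQ
    have hPtorsion : 2 ^ r * WittRing.mk P = 0 := by
      linear_combination hQ - two_pow_mul_eq_zero_of_mem_closure_binaryTorsion hmem
    rw [← sub_add_cancel (WittRing.mk Q) (WittRing.mk P)]
    exact add_mem hmem (ih P.dim (by lia) P hPtorsion rfl)

theorem mem_closure_binaryTorsion_of_mem_fundamentalIdeal {φ : WittRing F}
    (hφ : φ ∈ fundamentalIdeal F) (h : 2 ^ r * φ = 0) :
    φ ∈ AddSubmonoid.closure (binaryTorsion F r) := by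
  obtain ⟨Q, hQ, rfl⟩ := hφ
  by_cases h2 : (2 ^ r : WittRing F) = 0
  · exact mk_mem_closure_binaryTorsion_of_two_pow_eq_zero h2 hQ
  · exact mk_mem_closure_binaryTorsion_of_two_pow_ne_zero h2 Q h

theorem closure_binaryTorsion_le_dividedPowerSubmonoid :
    AddSubmonoid.closure (binaryTorsion F r) ≤
      dividedPowerSubmonoid 2 (Ideal.torsionOf (WittRing F) (WittRing F) (2 ^ r)) := by
  rw [AddSubmonoid.closure_le]
  rintro _ ⟨hu, a, c, rfl⟩
  refine mem_dividedPowerSubmonoid_of_mul_self_eq (y := rankOneClass a)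
    ((Ideal.mem_torsionOf_iff _ _).2 ((mul_comm _ _).trans hu)) ?_
  push_cast
  linear_combination rankOneClass_mul_self c - rankOneClass_mul_self a

theorem two_pow_sub_mul_pow_eq_zero {φ : WittRing F} (hφ : φ ∈ fundamentalIdeal F)
    (h : 2 ^ r * φ = 0) {n : ℕ} (hn : n ≠ 0) :
    2 ^ (r - padicValNat 2 n.factorial) * φ ^ n = 0 := by
  have hmem := closure_binaryTorsion_le_dividedPowerSubmonoid
    (mem_closure_binaryTorsion_of_mem_fundamentalIdeal hφ h)
  exact_mod_cast pow_sub_mul_pow_eq_zero_of_mem_dividedPowerSubmonoid (r := r)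
    (fun z hz => (mul_comm _ _).trans (by exact_mod_cast (Ideal.mem_torsionOf_iff _ _).1 hz))
    hmem hn

end BinaryTorsion

section EvenGenerators

open Polynomial

variable {r k : ℕ}

theorem aeval_eq_zero_of_mem_evenGenerators (hk : 1 ≤ k)
    (hrk : r ≤ padicValNat 2 (2 * k).factorial) {f : ℤ[X]} (hf : f ∈ evenGenerators r k)
    {φ : WittRing F} (hφ : φ ∈ fundamentalIdeal F) (h : 2 ^ r * φ = 0) : aeval φ f = 0 := by
  rcases hf with (rfl | ⟨i, hi, -, rfl⟩) | rfl
  · simpa [map_ofNat] using h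
  · simpa [map_ofNat] using two_pow_sub_mul_pow_eq_zero hφ h (n := 2 * i) (by lia)
  · simpa [Nat.sub_eq_zero_of_le hrk] using two_pow_sub_mul_pow_eq_zero hφ h (n := 2 * k) (by lia)

theorem evenGenerators_subset_span_X (hk : 1 ≤ k) :
    evenGenerators r k ⊆ (Ideal.span {X} : Ideal ℤ[X]) := by
  rintro f ((rfl | ⟨i, hi, -, rfl⟩) | rfl) <;> rw [SetLike.mem_coe, Ideal.mem_span_singleton]
  · exact dvd_mul_left _ _
  · exact (dvd_pow_self _ (by lia)).mul_left _
  · exact dvd_pow_self _ (by lia)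

end EvenGenerators

end QuadWitt

theorem mainTheorem5_general {F : Type u} [Field F] [Invertible (2 : F)] {r k : ℕ} (hk : 1 ≤ k)
    (hrk : r ≤ padicValNat 2 (Nat.factorial (2 * k)))
    (hr : ∀ φ ∈ QuadWitt.evenTorsion F, (2 ^ r : ℕ) • φ = 0) :
    (∀ f ∈ QuadWitt.evenGenerators r k, ∀ φ ∈ QuadWitt.evenTorsion F,
      Polynomial.aeval φ f = 0) ∧
    QuadWitt.evenIdeal r k ≤ QuadWitt.torsionAnnihilator' F := by
  have hvanish : ∀ f ∈ QuadWitt.evenGenerators r k, ∀ φ ∈ QuadWitt.evenTorsion F,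
      Polynomial.aeval φ f = 0 := fun f hf φ hφ =>
    QuadWitt.aeval_eq_zero_of_mem_evenGenerators hk hrk hf hφ.1 (by simpa using hr φ hφ)
  exact ⟨hvanish, Ideal.span_le.2 fun f hf =>
    ⟨hvanish f hf, QuadWitt.evenGenerators_subset_span_X hk hf⟩⟩

theorem mainTheorem5 {F : Type u} [Field F] [Invertible (2 : F)] (r k : ℕ) (hk : 1 ≤ k)
    (hkr : padicValNat 2 (Nat.factorial (2 * k - 2)) < r)
    (hrk : r ≤ padicValNat 2 (Nat.factorial (2 * k)))
    (hr : ∀ x ∈ QuadWitt.torsionPart F, (2 ^ r : ℕ) • x = 0) :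
    (∀ f ∈ QuadWitt.evenGenerators r k, ∀ φ ∈ QuadWitt.evenTorsion F,
      Polynomial.aeval φ f = 0) ∧
    QuadWitt.evenIdeal r k ≤ QuadWitt.torsionAnnihilator' F :=
  mainTheorem5_general hk hrk fun φ hφ => hr φ hφ.2
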